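/- **Setting.** Let $k$ be a field and $G$ a finite group. A *$G$-crossed module* is a $k$-vector space $V$ with a linear $G$-action $\triangleright$ and a grading $V=\bigoplus_{g\in G}V_g$ such that $h\triangleright V_g\subseteq V_{hgh^{-1}}$; morphisms are degree-preserving $G$-equivariant linear maps. Tensor products have the diagonal action and $|v\otimes w|=|v||w|$, the unit object is $k$ (trivial action, degree $e$), the dual $V^\sharp=V^*$ has $(h\triangleright\phi)(v)=\phi(h^{-1}\triangleright v)$ with the dual of $V_g$ in degree $g^{-1}$, and the braiding is $\Psi(v\otimes w)=|v|\triangleright w\otimes v$. A *left braided-Lie algebra* in $G$-crossed modules is a counital coalgebra $(\mathcal L,\Delta,\epsilon)$ in this category with a morphism $[\ ,\ ]:\mathcal L\otimes\mathcal L\to\mathcal L$ such that * (L1) $[\ ,\ ](\mathrm{id}\otimes[\ ,\ ])=[\ ,\ ]([\ ,\ ]\otimes[\ ,\ ])(\mathrm{id}\otimes\Psi\otimes\mathrm{id})(\Delta\otimes\mathrm{id}\otimes\mathrm{id})$; * (L2) $(\mathrm{id}\otimes[\ ,\ ])(\Delta\otimes\mathrm{id})=\Psi\circ\widetilde\Psi$,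 where $\widetilde\Psi:=([\ ,\ ]\otimes\mathrm{id})(\mathrm{id}\otimes\Psi)(\Delta\otimes\mathrm{id})$ is the *fundamental braiding*; * (L3) $\Delta[\ ,\ ]=([\ ,\ ]\otimes[\ ,\ ])(\mathrm{id}\otimes\Psi\otimes\mathrm{id})(\Delta\otimes\Delta)$ and $\epsilon[\ ,\ ]=\epsilon\otimes\epsilon$. It is *regular* if $\widetilde\Psi$ is invertible, and *unital* if there is a morphism of coalgebras $\eta:k\to\mathcal L$ in the category (with $1\in k$ grouplike) such that (L4) $[\eta(1),x]=x$ and $[x,\eta(1)]=\epsilon(x)\eta(1)$ for all $x\in\mathcal L$. Let $\mathcal C\subseteq G$ be a conjugacy class, $r\in\mathcal C$, $C_G$ the centraliser of $r$, $q:\mathcal C\to G$ a map with $q_crq_c^{-1}=c$ and $q_r=e$, and $\zeta_c(g)=q_{gcg^{-1}}^{-1}gq_c\in C_G$. Let $\pi$ be a finite-dimensional representation of $C_G$ on $V_\pi$ (for example an irreducible one), $\{v_i\}$ a basis of $V_\pi$ with dual basis $\{v^i\}$, and $\pi(n)v_i=\pi(n)^j{}_iv_j$ (repeated basis indices of $V_\pi$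 are summed). Let $V_{\mathcal C,\pi}=k\mathcal C\otimes V_\pi$ be the crossed module with $h\triangleright(c\otimes w)=hch^{-1}\otimes\pi(\zeta_c(h))w$ and $|c\otimes w|=c$. Write $E_{ai}=a\otimes v_i$, $E^{bj}=\delta_b\otimes v^j$ for the dual basis of $V_{\mathcal C,\pi}^\sharp$, and $E_{ai}{}^{bj}=E_{ai}\otimes E^{bj}$ for the resulting basis of $\mathrm{End}(V_{\mathcal C,\pi})=V_{\mathcal C,\pi}\otimes V_{\mathcal C,\pi}^\sharp$. **Proposition.** (1) The crossed module structure of $\mathrm{End}(V_{\mathcal C,\pi})=V_{\mathcal C,\pi}\otimes V_{\mathcal C,\pi}^\sharp$ is $$h\triangleright E_{ai}{}^{bj}=\pi(\zeta_a(h))^k{}_i\,\pi(\zeta_b(h)^{-1})^j{}_l\,E_{(hah^{-1})k}{}^{(hbh^{-1})l},\qquad |E_{ai}{}^{bj}|=ab^{-1},$$ and with it $\mathrm{End}(V_{\mathcal C,\pi})$ is a regular left braided-Lie algebra $\mathcal L_{\mathcal C,\pi}$ in the category of $G$-crossed modules, with the matrix coalgebra $$\Delta E_{ai}{}^{bj}=\sum_{c\in\mathcal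 C}E_{ai}{}^{ck}\otimes E_{ck}{}^{bj},\qquad \epsilon(E_{ai}{}^{bj})=\delta_{a,b}\delta_i^j,$$ and, for $x=E_{ck}{}^{dl}$ and $w=|b^{-1}\triangleright x|=b^{-1}cd^{-1}b$, with bracket and fundamental braiding $$[E_{ai}{}^{bj},x]=\delta_{ab^{-1}cd^{-1},\,w}\;\pi(\zeta_a(w^{-1}))^j{}_i\;b^{-1}\triangleright x,\qquad \widetilde\Psi(E_{ai}{}^{bj}\otimes x)=b^{-1}\triangleright x\otimes\big((w^{-1}\triangleright E_{ai})\otimes E^{bj}\big).$$ This $\mathcal L_{\mathcal C,\pi}$ is unital if and only if $\dim V_{\mathcal C,\pi}=1$. (2) Let $S$ be any family of such data $(\mathcal C,\pi)$. Then the direct sum of crossed modules $\mathcal L=\bigoplus_{(\mathcal C,\pi)\in S}\mathrm{End}(V_{\mathcal C,\pi})$ is a regular left braided-Lie algebra with the direct sum of the matrix coalgebras, and with bracket and fundamental braiding given by the same formulas for $E_{ai}{}^{bj}$ in the block of $(\mathcal C,\pi)$ and $x=E_{c'k'}{}^{d'l'}$ in the block of a possibly different $(\mathcal C',\pi')$,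 where $\zeta_a$, $\pi$ and the action on $E_{ai}$ are those of $(\mathcal C,\pi)$. If $S$ contains the trivial pair $(\{e\},1)$, then $\mathcal L$ is unital with $\eta(1)=1\in\mathrm{End}(V_{\{e\},1})\cong k$. -/

import Mathlib

open scoped TensorProduct DirectSum

/-- A (Whitehead) `G`-crossed module structure on the `k`-vector space `V`, for a finite group `G`:
a linear action of `G` and a `G`-grading with `h ▷ V_g ⊆ V_{h g h⁻¹}`.  The grading is recorded by
the projections `proj g : V → V` onto its homogeneous components `V_g = {v | proj g v = v}`
(equivalently, by the action of the idempotents `δ_g` of `k(G)`). -/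
structure CrossedModule (k G V : Type*) [Field k] [Group G] [Fintype G] [DecidableEq G]
    [AddCommGroup V] [Module k V] where
  act : Representation k G V
  proj : G → V →ₗ[k] V
  proj_comp_proj : ∀ g h, proj g ∘ₗ proj h = if g = h then proj g else 0
  sum_proj : ∑ g, proj g = LinearMap.id
  act_comp_proj : ∀ h g, act h ∘ₗ proj g = proj (h * g * h⁻¹) ∘ₗ act h

namespace CrossedModule

variable {k G V W : Type*} [Field k] [Group G] [Fintype G] [DecidableEq G]
  [AddCommGroup V] [Module k V] [AddCommGroup W] [Module k W]

theorem proj_proj (X : CrossedModule k G V) (g h : G) (x : V) :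
    X.proj g (X.proj h x) = if g = h then X.proj g x else 0 := by
  have := LinearMap.congr_fun (X.proj_comp_proj g h) x
  simp only [LinearMap.comp_apply] at this
  rw [this]; split_ifs <;> rfl

theorem sum_proj_apply (X : CrossedModule k G V) (x : V) : ∑ g, X.proj g x = x := by
  have := LinearMap.congr_fun X.sum_proj x
  simpa [LinearMap.sum_apply] using this

theorem act_proj (X : CrossedModule k G V) (h g : G) (x : V) :
    X.act h (X.proj g x) = X.proj (h * g * h⁻¹) (X.act h x) :=
  LinearMap.congr_fun (X.act_comp_proj h g) x

/-- The homogeneous components are indeed a grading of `V`. -/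
theorem isInternal (X : CrossedModule k G V) :
    DirectSum.IsInternal (fun g => LinearMap.range (X.proj g)) := by
  refine DirectSum.isInternal_submodule_of_iSupIndep_of_iSup_eq_top ?_ ?_
  · rw [iSupIndep_def]
    intro g
    rw [Submodule.disjoint_def]
    rintro _ ⟨x, rfl⟩ hx
    have key : (⨆ j, ⨆ (_ : j ≠ g), LinearMap.range (X.proj j)) ≤ LinearMap.ker (X.proj g) := by
      refine iSup₂_le fun j hj => ?_
      rintro _ ⟨y, rfl⟩
      simp [X.proj_proj, hj.symm]
    have := key hx
    simpa [X.proj_proj] using this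
  · rw [eq_top_iff]
    intro x _
    rw [← X.sum_proj_apply x]
    exact Submodule.sum_mem _ fun g _ =>
      Submodule.mem_iSup_of_mem (p := fun g => LinearMap.range (X.proj g)) g ⟨x, rfl⟩

/-- Morphisms of crossed modules: linear maps that commute with the action and preserve the
grading. -/
def IsHom (X : CrossedModule k G V) (Y : CrossedModule k G W) (f : V →ₗ[k] W) : Prop :=
  (∀ h, f ∘ₗ X.act h = Y.act h ∘ₗ f) ∧ (∀ g, f ∘ₗ X.proj g = Y.proj g ∘ₗ f)

/-- The unit object: `k` with trivial action, concentrated in degree `1`. -/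
def unit (k G : Type*) [Field k] [Group G] [Fintype G] [DecidableEq G] : CrossedModule k G k where
  act := 1
  proj g := if g = 1 then LinearMap.id else 0
  proj_comp_proj g h := by
    by_cases hg : g = 1 <;> by_cases hh : h = 1 <;> by_cases hgh : g = h <;> simp_all
  sum_proj := by simp
  act_comp_proj h g := by
    have : h * g * h⁻¹ = 1 ↔ g = 1 := by
      rw [mul_inv_eq_one, mul_eq_left]
    by_cases hg : g = 1 <;> simp [this, hg]

/-- The tensor product: diagonal action, `|v ⊗ w| = |v||w|`. -/
noncomputable def tensor (X : CrossedModule k G V) (Y : CrossedModule k G W) :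
    CrossedModule k G (V ⊗[k] W) where
  act := X.act.tprod Y.act
  proj g := ∑ a, TensorProduct.map (X.proj a) (Y.proj (a⁻¹ * g))
  proj_comp_proj g h := by
    ext v w
    simp only [TensorProduct.AlgebraTensorModule.curry_apply, LinearMap.restrictScalars_self,
      TensorProduct.curry_apply, LinearMap.comp_apply, LinearMap.sum_apply,
      TensorProduct.map_tmul, map_sum, X.proj_proj, Y.proj_proj]
    have : ∀ a b : G, ((if b = a then X.proj b v else 0) ⊗ₜ[k]
        (if b⁻¹ * g = a⁻¹ * h then Y.proj (b⁻¹ * g) w else 0)) =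
        if b = a then (if g = h then X.proj b v ⊗ₜ[k] Y.proj (b⁻¹ * g) w else 0) else 0 := by
      intro a b
      by_cases hab : b = a
      · subst hab
        by_cases hgh : g = h <;> simp [hgh]
      · simp [hab]
    simp only [this, Finset.sum_ite_eq', Finset.mem_univ, if_true]
    split_ifs <;> simp [LinearMap.sum_apply]
  sum_proj := by
    ext v w
    simp only [TensorProduct.AlgebraTensorModule.curry_apply, LinearMap.restrictScalars_self,
      TensorProduct.curry_apply, LinearMap.sum_apply, TensorProduct.map_tmul, LinearMap.id_apply]
    rw [Finset.sum_comm]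
    have : ∀ a : G, ∑ g, X.proj a v ⊗ₜ[k] Y.proj (a⁻¹ * g) w = X.proj a v ⊗ₜ[k] w := by
      intro a
      rw [← TensorProduct.tmul_sum, (Group.mulLeft_bijective a⁻¹).sum_comp (fun g => Y.proj g w),
        Y.sum_proj_apply]
    simp only [this, ← TensorProduct.sum_tmul, X.sum_proj_apply]
  act_comp_proj h g := by
    ext v w
    simp only [TensorProduct.AlgebraTensorModule.curry_apply, LinearMap.restrictScalars_self,
      TensorProduct.curry_apply, LinearMap.comp_apply, LinearMap.sum_apply, map_sum,
      Representation.tprod_apply, TensorProduct.map_tmul, X.act_proj, Y.act_proj]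
    refine Fintype.sum_equiv (MulAut.conj h).toEquiv _ _ fun a => ?_
    simp [mul_assoc]

/-- The categorical dual `V^♯` on the linear dual: `(h ▷ φ)(v) = φ(h⁻¹ ▷ v)`, and the dual of `V_g`
has degree `g⁻¹`. -/
noncomputable def dual (X : CrossedModule k G V) : CrossedModule k G (Module.Dual k V) where
  act := X.act.dual
  proj g := (X.proj g⁻¹).dualMap
  proj_comp_proj g h := by
    ext φ v
    simp only [LinearMap.comp_apply, LinearMap.dualMap_apply, X.proj_proj]
    by_cases hgh : g = h
    · simp [hgh]
    · have : ¬ h = g := fun h' => hgh h'.symm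
      simp [hgh, this]
  sum_proj := by
    ext φ v
    simp only [LinearMap.sum_apply, LinearMap.dualMap_apply, LinearMap.id_apply]
    rw [← map_sum, Fintype.sum_equiv (Equiv.inv G) (fun g => X.proj g⁻¹ v)
      (fun g => X.proj g v) fun _ => rfl, X.sum_proj_apply]
  act_comp_proj h g := by
    ext φ v
    simp [Representation.dual_apply, Module.Dual.transpose_apply, X.act_proj, mul_assoc]

/-- The direct sum of a family of crossed modules. -/
noncomputable def directSum {S : Type*} {V : S → Type*} [∀ s, AddCommGroup (V s)]
    [∀ s, Module k (V s)] (X : ∀ s, CrossedModule k G (V s)) :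
    CrossedModule k G (⨁ s, V s) where
  act :=
    { toFun := fun g => DirectSum.lmap fun s => (X s).act g
      map_one' := by
        ext x s
        simp
      map_mul' := fun g h => by
        ext x s
        simp }
  proj g := DirectSum.lmap fun s => (X s).proj g
  proj_comp_proj g h := by
    classical
    refine DirectSum.linearMap_ext _ fun s => LinearMap.ext fun v => ?_
    simp only [LinearMap.comp_apply, DirectSum.lmap_lof, (X s).proj_proj]
    split_ifs <;> simp
  sum_proj := by
    classical
    refine DirectSum.linearMap_ext _ fun s => LinearMap.ext fun v => ?_
    simp only [LinearMap.comp_apply, LinearMap.sum_apply, DirectSum.lmap_lof]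
    rw [← map_sum, (X s).sum_proj_apply, LinearMap.id_apply]
  act_comp_proj h g := by
    classical
    refine DirectSum.linearMap_ext _ fun s => LinearMap.ext fun v => ?_
    simp [(X s).act_proj]

/-- The braiding `Ψ_{V,W}(v ⊗ w) = |v| ▷ w ⊗ v`. -/
noncomputable def braiding (X : CrossedModule k G V) (Y : CrossedModule k G W) :
    V ⊗[k] W →ₗ[k] W ⊗[k] V :=
  (∑ g, TensorProduct.map (Y.act g) (X.proj g)) ∘ₗ (TensorProduct.comm k V W).toLinearMap

theorem braiding_tmul (X : CrossedModule k G V) (Y : CrossedModule k G W) {g : G} {v : V}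
    (hv : X.proj g v = v) (w : W) : X.braiding Y (v ⊗ₜ w) = Y.act g w ⊗ₜ v := by
  have h : ∀ a, X.proj a v = if a = g then v else 0 := by
    intro a
    rw [← hv, X.proj_proj]
    split_ifs with h
    · rw [h]
    · rfl
  simp only [braiding, LinearMap.comp_apply, LinearEquiv.coe_coe, TensorProduct.comm_tmul,
    LinearMap.sum_apply, TensorProduct.map_tmul, h]
  rw [Finset.sum_eq_single g] <;> simp +contextual

end CrossedModule

section BraidedLie

variable {k G L : Type*} [Field k] [Group G] [Fintype G] [DecidableEq G]
  [AddCommGroup L] [Module k L]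

/-- `id ⊗ Ψ ⊗ id : (L ⊗ L) ⊗ (L ⊗ L) → (L ⊗ L) ⊗ (L ⊗ L)`. -/
noncomputable def middleBraid (X : CrossedModule k G L) :
    (L ⊗[k] L) ⊗[k] (L ⊗[k] L) →ₗ[k] (L ⊗[k] L) ⊗[k] (L ⊗[k] L) :=
  (TensorProduct.assoc k L L (L ⊗[k] L)).symm.toLinearMap ∘ₗ
    LinearMap.lTensor L
      ((TensorProduct.assoc k L L L).toLinearMap ∘ₗ
        LinearMap.rTensor L (X.braiding X) ∘ₗ
          (TensorProduct.assoc k L L L).symm.toLinearMap) ∘ₗ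
      (TensorProduct.assoc k L L (L ⊗[k] L)).toLinearMap

/-- The map `Ψ̃ = ([ , ] ⊗ id)(id ⊗ Ψ)(Δ ⊗ id)` built from a coproduct and a bracket. -/
noncomputable def fundamentalBraidingOf (X : CrossedModule k G L) (comul : L →ₗ[k] L ⊗[k] L)
    (bracket : L ⊗[k] L →ₗ[k] L) : L ⊗[k] L →ₗ[k] L ⊗[k] L :=
  LinearMap.rTensor L bracket ∘ₗ
    (TensorProduct.assoc k L L L).symm.toLinearMap ∘ₗ
      LinearMap.lTensor L (X.braiding X) ∘ₗ
        (TensorProduct.assoc k L L L).toLinearMap ∘ₗ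
          LinearMap.rTensor L comul

/-- A left braided-Lie algebra in the braided category of `G`-crossed modules, on the object `X`:
a coalgebra in the category together with a morphism `[ , ] : L ⊗ L → L` satisfying
the braided Jacobi identity (L1), braided cocommutativity (L2), and the
requirement that `[ , ]` is a map of (braided) coalgebras (L3). -/
structure LeftBraidedLieAlgebra (X : CrossedModule k G L) extends Coalgebra k L where
  bracket : L ⊗[k] L →ₗ[k] L
  comul_isHom : X.IsHom (X.tensor X) comul
  counit_isHom : X.IsHom (CrossedModule.unit k G) counit
  bracket_isHom : (X.tensor X).IsHom X bracket
  /-- (L1): `[ , ](id ⊗ [ , ]) = [ , ]([ , ] ⊗ [ , ])(id ⊗ Ψ ⊗ id)(Δ ⊗ id ⊗ id)`. -/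
  jacobi : bracket ∘ₗ LinearMap.lTensor L bracket =
    bracket ∘ₗ TensorProduct.map bracket bracket ∘ₗ middleBraid X ∘ₗ
      LinearMap.rTensor (L ⊗[k] L) comul
  /-- (L2): `(id ⊗ [ , ])(Δ ⊗ id) = Ψ([ , ] ⊗ id)(id ⊗ Ψ)(Δ ⊗ id)`. -/
  cocomm : LinearMap.lTensor L bracket ∘ₗ (TensorProduct.assoc k L L L).toLinearMap ∘ₗ
      LinearMap.rTensor L comul =
    X.braiding X ∘ₗ fundamentalBraidingOf X comul bracket
  /-- (L3): `Δ[ , ] = ([ , ] ⊗ [ , ])(id ⊗ Ψ ⊗ id)(Δ ⊗ Δ)`. -/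
  comul_bracket : comul ∘ₗ bracket =
    TensorProduct.map bracket bracket ∘ₗ middleBraid X ∘ₗ TensorProduct.map comul comul
  /-- (L3): `ε[ , ] = ε ⊗ ε`. -/
  counit_bracket : counit ∘ₗ bracket =
    (TensorProduct.lid k k).toLinearMap ∘ₗ TensorProduct.map counit counit

namespace LeftBraidedLieAlgebra

variable {X : CrossedModule k G L}

/-- The fundamental braiding `Ψ̃`. -/
noncomputable def fundamentalBraiding (A : LeftBraidedLieAlgebra X) :
    L ⊗[k] L →ₗ[k] L ⊗[k] L :=
  fundamentalBraidingOf X A.comul A.bracket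

/-- Regularity: the fundamental braiding is invertible. -/
def IsRegular (A : LeftBraidedLieAlgebra X) : Prop :=
  Function.Bijective A.fundamentalBraiding

/-- `η` is a unit for the braided-Lie algebra: a morphism of coalgebras in the category from the
unit object (whose `1` is grouplike), with (L4): `[η, x] = x` and `[x, η] = ε(x) η`. -/
structure IsUnitMap (A : LeftBraidedLieAlgebra X) (η : k →ₗ[k] L) : Prop where
  isHom : (CrossedModule.unit k G).IsHom X η
  comul_unit : A.comul (η 1) = η 1 ⊗ₜ η 1
  counit_unit : A.counit (η 1) = 1
  unit_bracket : ∀ x, A.bracket (η 1 ⊗ₜ x) = x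
  bracket_unit : ∀ x, A.bracket (x ⊗ₜ η 1) = A.counit x • η 1

/-- A braided-Lie algebra is unital if it has a unit. -/
def IsUnital (A : LeftBraidedLieAlgebra X) : Prop := ∃ η, A.IsUnitMap η

end LeftBraidedLieAlgebra

end BraidedLie

/-- A conjugacy class `𝒞` of `G` with a chosen element `r ∈ 𝒞` and a chosen map `q : 𝒞 → G` with
`q_c r q_c⁻¹ = c` and `q_r = e`. -/
structure BasedClass (G : Type*) [Group G] where
  r : G
  q : conjugatesOf r → G
  q_conj : ∀ c, q c * r * (q c)⁻¹ = c
  q_base : q ⟨r, mem_conjugatesOf_self⟩ = 1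

namespace BasedClass

variable {G : Type*} [Group G] (D : BasedClass G)

/-- The conjugacy class `𝒞`. -/
abbrev cls : Type _ := conjugatesOf D.r

/-- The isotropy group `C_G`, the centraliser of `r`. -/
abbrev isotropy : Subgroup G := Subgroup.centralizer {D.r}

/-- The action `c ↦ h c h⁻¹` of `G` on `𝒞`. -/
def conj (h : G) (c : D.cls) : D.cls :=
  ⟨h * c * h⁻¹, (show IsConj D.r c from c.2).trans (isConj_iff.2 ⟨h, rfl⟩)⟩

theorem conj_one (c : D.cls) : D.conj 1 c = c := Subtype.ext (by simp [conj])

theorem conj_mul (g h : G) (c : D.cls) : D.conj (g * h) c = D.conj g (D.conj h c) :=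
  Subtype.ext (by simp [conj, mul_assoc])

/-- The cocycle `ζ_c(g) = q_{g c g⁻¹}⁻¹ g q_c ∈ C_G`. -/
def zeta (c : D.cls) (g : G) : D.isotropy :=
  ⟨(D.q (D.conj g c))⁻¹ * g * D.q c, by
    rw [Subgroup.mem_centralizer_singleton_iff]
    have h1 : D.q (D.conj g c) * D.r * (D.q (D.conj g c))⁻¹ =
        g * (D.q c * D.r * (D.q c)⁻¹) * g⁻¹ := by
      rw [D.q_conj, D.q_conj]; rfl
    have h3 : D.q (D.conj g c) * D.r = g * D.q c * D.r * (D.q c)⁻¹ * g⁻¹ * D.q (D.conj g c) := by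
      rw [← mul_inv_eq_iff_eq_mul]
      simpa [mul_assoc] using h1
    have h4 : D.r = (D.q (D.conj g c))⁻¹ *
        (g * D.q c * D.r * (D.q c)⁻¹ * g⁻¹ * D.q (D.conj g c)) := by
      rw [← h3]; group
    calc (D.q (D.conj g c))⁻¹ * g * D.q c * D.r
        = ((D.q (D.conj g c))⁻¹ * (g * D.q c * D.r * (D.q c)⁻¹ * g⁻¹ * D.q (D.conj g c))) *
            ((D.q (D.conj g c))⁻¹ * g * D.q c) := by group
      _ = D.r * ((D.q (D.conj g c))⁻¹ * g * D.q c) := by rw [← h4]⟩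

theorem zeta_one (c : D.cls) : D.zeta c 1 = 1 :=
  Subtype.ext (by simp [zeta, conj_one])

theorem zeta_mul (c : D.cls) (g h : G) :
    D.zeta c (g * h) = D.zeta (D.conj h c) g * D.zeta c h :=
  Subtype.ext (by simp [zeta, conj_mul, mul_assoc])

end BasedClass

section Block

variable {k G W : Type*} [Field k] [Group G] [Fintype G] [DecidableEq G]
  [AddCommGroup W] [Module k W]

/-- The vector space `V_{𝒞,π} = k𝒞 ⊗ V_π`, as finitely supported functions `𝒞 → V_π`;
`c ⊗ w` is `Finsupp.single c w`. -/
abbrev BlockV (D : BasedClass G) (W : Type*) [AddCommGroup W] : Type _ := D.cls →₀ W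

/-- The crossed module `V_{𝒞,π}`: `h ▷ (c ⊗ w) = h c h⁻¹ ⊗ π(ζ_c(h)) w` and `|c ⊗ w| = c`. -/
noncomputable def blockCrossed (D : BasedClass G) (π : Representation k D.isotropy W) :
    CrossedModule k G (BlockV D W) where
  act :=
    { toFun := fun h => Finsupp.lsum k fun c => Finsupp.lsingle (D.conj h c) ∘ₗ π (D.zeta c h)
      map_one' := by
        ext c w : 2
        simp [D.conj_one, D.zeta_one]
      map_mul' := fun g h => by
        ext c w : 2
        simp [D.conj_mul, D.zeta_mul] }
  proj g := Finsupp.lsum k fun c => if (c : G) = g then Finsupp.lsingle c else 0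
  proj_comp_proj g h := by
    ext c w : 2
    by_cases hg : (c : G) = g <;> by_cases hh : (c : G) = h <;> by_cases hgh : g = h <;> simp_all
  sum_proj := by
    ext c w : 2
    simp only [LinearMap.comp_apply, LinearMap.sum_apply, Finsupp.lsum_single,
      Finsupp.lsingle_apply, LinearMap.id_apply]
    rw [Finset.sum_eq_single (c : G)] <;> simp +contextual [eq_comm]
  act_comp_proj h g := by
    ext c w : 2
    have : h * (c : G) = h * g ↔ (c : G) = g := mul_right_inj h
    by_cases hg : (c : G) = g <;> simp [BasedClass.conj, hg, this]

/-- `End(V_{𝒞,π})`, identified with `V_{𝒞,π} ⊗ V_{𝒞,π}^♯`. -/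
abbrev BlockEnd (k : Type*) [Field k] (D : BasedClass G) (W : Type*) [AddCommGroup W]
    [Module k W] : Type _ :=
  BlockV D W ⊗[k] Module.Dual k (BlockV D W)

/-- The crossed module structure of `End(V_{𝒞,π}) = V_{𝒞,π} ⊗ V_{𝒞,π}^♯`. -/
noncomputable def blockEndCrossed (D : BasedClass G) (π : Representation k D.isotropy W) :
    CrossedModule k G (BlockEnd k D W) :=
  (blockCrossed D π).tensor (blockCrossed D π).dual

variable {I : Type*}

/-- The basis vectors `E_{ai} = a ⊗ v_i` of `V_{𝒞,π}`. -/
noncomputable def vecE (D : BasedClass G) (v : Module.Basis I k W) (a : D.cls) (i : I) :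
    BlockV D W :=
  Finsupp.single a (v i)

/-- The dual basis vectors `E^{bj} = δ_b ⊗ v^j` of `V_{𝒞,π}^♯`. -/
noncomputable def covecE (D : BasedClass G) (v : Module.Basis I k W) (b : D.cls) (j : I) :
    Module.Dual k (BlockV D W) :=
  v.coord j ∘ₗ Finsupp.lapply b

/-- The basis `E_{ai}^{bj} = E_{ai} ⊗ E^{bj}` of `End(V_{𝒞,π})`. -/
noncomputable def matE (D : BasedClass G) (v : Module.Basis I k W) (a : D.cls) (i : I)
    (b : D.cls) (j : I) : BlockEnd k D W :=
  vecE D v a i ⊗ₜ covecE D v b j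

/-- The matrix entry `π(n)^j_i`, that is `π(n) v_i = ∑_j π(n)^j_i v_j`. -/
noncomputable def matrixCoeff {D : BasedClass G} (π : Representation k D.isotropy W)
    (v : Module.Basis I k W) (n : D.isotropy) (j i : I) : k :=
  v.repr (π n (v i)) j

end Block

/-! Let `φ` be a functional on `V` supported on `V_b`, so of degree `b⁻¹` in the dual, let `x` be
homogeneous, and put `w = |b⁻¹ ▷ x|`. Pass `x` leftwards through `V ⊗ V^♯`, crossing `φ` by the
braiding and `v` by the inverse braiding: `v ⊗ φ ⊗ x ↦ b⁻¹ ▷ x ⊗ (w⁻¹ ▷ v) ⊗ φ`. This is the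
fundamental braiding, visibly invertible, and evaluating `φ` on `w⁻¹ ▷ v` afterwards gives the
bracket `φ(w⁻¹ ▷ v) • b⁻¹ ▷ x`.

The formula uses only the crossed module structure on the side of `x`, so `x` may lie in another
block. All blocks are therefore treated at once, over a sum of matrix objects with homogeneous bases
(`MatrixBlocks`); a single block is the case of one summand. The same formula describes the action
on `L ⊗ L` induced by the coproduct (`map_bracket_tensor`), so (L3) is naturality with respect to
the morphisms `comul` and `counit`. (L1) is equivariance of the bracket together with preservation
of degree (`mul_eq_of_coeff_ne_zero`), and (L2) is a dual basis expansion.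

A unit gives a grouplike element. In the matrix coalgebra of size `n` this is an algebra map from `n
× n` matrices to `k`, which forces `n = 1`. Conversely the identity matrix of a one-dimensional
block is a unit for that block alone, and for the whole sum if the block is trivial. -/

/-! ### Homogeneous elements and functionals in crossed modules. -/

namespace CrossedModule

variable {k G V W N : Type*} [Field k] [Group G] [Fintype G] [DecidableEq G]
  [AddCommGroup V] [Module k V] [AddCommGroup W] [Module k W] [AddCommGroup N] [Module k N]

theorem proj_of_ne (X : CrossedModule k G V) {g h : G} {x : V} (hx : X.proj h x = x)
    (hne : g ≠ h) : X.proj g x = 0 := by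
  rw [← hx, X.proj_proj, if_neg hne]

theorem proj_eq_ite (X : CrossedModule k G V) {h : G} {x : V} (hx : X.proj h x = x) (g : G) :
    X.proj g x = if h = g then x else 0 := by
  split_ifs with hg
  · rw [← hg, hx]
  · exact X.proj_of_ne hx (Ne.symm hg)

theorem proj_act (X : CrossedModule k G V) {u : G} {x : V} (hx : X.proj u x = x) (h : G) :
    X.proj (h * u * h⁻¹) (X.act h x) = X.act h x := by
  rw [← X.act_proj, hx]

theorem act_act (X : CrossedModule k G V) (g h : G) (x : V) :
    X.act g (X.act h x) = X.act (g * h) x := by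
  rw [map_mul]; rfl

theorem act_one (X : CrossedModule k G V) (x : V) : X.act 1 x = x := by
  rw [map_one]; rfl

theorem proj_tmul (X : CrossedModule k G V) (Y : CrossedModule k G W) {a b : G} {x : V} {y : W}
    (hx : X.proj a x = x) (hy : Y.proj b y = y) :
    (X.tensor Y).proj (a * b) (x ⊗ₜ y) = x ⊗ₜ y := by
  simp only [tensor, LinearMap.sum_apply, TensorProduct.map_tmul]
  rw [Finset.sum_eq_single a]
  · simp [hx, hy]
  · intro c _ hc
    rw [X.proj_of_ne hx hc, TensorProduct.zero_tmul]
  · simp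

theorem act_tmul (X : CrossedModule k G V) (Y : CrossedModule k G W) (h : G) (x : V) (y : W) :
    (X.tensor Y).act h (x ⊗ₜ y) = X.act h x ⊗ₜ Y.act h y := rfl

theorem dual_act_apply (X : CrossedModule k G V) (h : G) (φ : Module.Dual k V) :
    X.dual.act h φ = φ ∘ₗ X.act h⁻¹ := rfl

/-- The condition `φ ∘ₗ X.proj b = φ`, that `φ` is supported on `V_b`, is the form in which
homogeneity of functionals is used throughout; the dual degree is the inverse `b⁻¹`. -/
theorem dual_proj (X : CrossedModule k G V) {b : G} {φ : Module.Dual k V}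
    (hφ : φ ∘ₗ X.proj b = φ) : X.dual.proj b⁻¹ φ = φ := by
  simp only [dual, inv_inv]
  exact hφ

theorem comp_act_comp_proj (X : CrossedModule k G V) {b : G} {φ : Module.Dual k V}
    (hφ : φ ∘ₗ X.proj b = φ) (h : G) :
    (φ ∘ₗ X.act h⁻¹) ∘ₗ X.proj (h * b * h⁻¹) = φ ∘ₗ X.act h⁻¹ := by
  rw [LinearMap.comp_assoc, X.act_comp_proj]
  conv_rhs => rw [← hφ]
  simp [mul_assoc, LinearMap.comp_assoc]

/-- This is why the bracket preserves degree. With `w = b⁻¹ub`, the vector `w⁻¹ ▷ v` has degree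
`w⁻¹aw`, and `φ` sees only degree `b`; hence `a = wbw⁻¹`, which rearranges to the claim. -/
theorem mul_eq_of_coeff_ne_zero (X : CrossedModule k G V) {a b u : G} {v : V}
    {φ : Module.Dual k V}
    (hv : X.proj a v = v) (hφ : φ ∘ₗ X.proj b = φ)
    (hne : φ (X.act (b⁻¹ * u * b)⁻¹ v) ≠ 0) : a * b⁻¹ * u = b⁻¹ * u * b := by
  by_contra h
  apply hne
  rw [← hφ, LinearMap.comp_apply, X.proj_of_ne (X.proj_act hv _), map_zero]
  intro hb
  apply h
  have : ∀ w, b = w⁻¹ * a * w⁻¹⁻¹ → a = w * b * w⁻¹ := by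
    rintro w rfl
    group
  have := this _ hb
  rw [this]
  group

theorem hom_ext (X : CrossedModule k G V) {f g : V →ₗ[k] N}
    (h : ∀ u x, X.proj u x = x → f x = g x) : f = g := by
  ext x
  rw [← X.sum_proj_apply x, map_sum, map_sum]
  exact Finset.sum_congr rfl fun u _ => h u _ (by simp [X.proj_proj])

theorem IsHom.act {X : CrossedModule k G V} {Y : CrossedModule k G W} {f : V →ₗ[k] W}
    (hf : X.IsHom Y f) (h : G) (x : V) : f (X.act h x) = Y.act h (f x) :=
  LinearMap.congr_fun (hf.1 h) x

theorem IsHom.proj {X : CrossedModule k G V} {Y : CrossedModule k G W} {f : V →ₗ[k] W}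
    (hf : X.IsHom Y f) {u : G} {x : V} (hx : X.proj u x = x) : Y.proj u (f x) = f x := by
  have := LinearMap.congr_fun (hf.2 u) x
  simp only [LinearMap.comp_apply, hx] at this
  exact this.symm

end CrossedModule

/-- Basis independence of the canonical element of `V^* ⊗ V`. It yields equivariance of the matrix
coproduct and invariance of the identity matrix. -/
theorem Module.Basis.sum_coord_comp_symm {k V N ι : Type*} [Field k] [AddCommGroup V] [Module k V]
    [AddCommGroup N] [Module k N] [Fintype ι] (b : Module.Basis ι k V)
    (T T' : V →ₗ[k] V) (hT : T ∘ₗ T' = LinearMap.id)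
    (F : Module.Dual k V →ₗ[k] V →ₗ[k] N) :
    ∑ i, F (b.coord i ∘ₗ T') (T (b i)) = ∑ i, F (b.coord i) (b i) := by
  have h1 : ∀ i, T (b i) = ∑ j, (b.coord j (T (b i))) • b j := fun i => (b.sum_repr _).symm
  calc ∑ i, F (b.coord i ∘ₗ T') (T (b i))
      = ∑ i, ∑ j, (b.coord j (T (b i))) • F (b.coord i ∘ₗ T') (b j) := by
        refine Finset.sum_congr rfl fun i _ => ?_
        conv_lhs => rw [h1 i]
        simp only [map_sum, map_smul]
    _ = ∑ j, F ((∑ i, ((b.coord j ∘ₗ T) (b i)) • b.coord i) ∘ₗ T') (b j) := by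
        rw [Finset.sum_comm]
        refine Finset.sum_congr rfl fun j _ => ?_
        rw [← LinearMap.lcomp_apply' (S := k), map_sum, map_sum, LinearMap.sum_apply]
        simp [LinearMap.lcomp_apply']
    _ = ∑ j, F (b.coord j) (b j) := by
        refine Finset.sum_congr rfl fun j _ => ?_
        rw [b.sum_dual_apply_smul_coord, LinearMap.comp_assoc, hT, LinearMap.comp_id]

/-! ### The fundamental braiding inside the braided axioms. -/

section Braid

variable {k G L : Type*} [Field k] [Group G] [Fintype G] [DecidableEq G]
  [AddCommGroup L] [Module k L]

/-- Purely formal, for any coproduct and bracket: it reduces the right sides of (L1) and (L3) to the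
fundamental braiding followed by one more bracket. -/
theorem map_bracket_middleBraid (X : CrossedModule k G L) (comul : L →ₗ[k] L ⊗[k] L)
    (bracket : L ⊗[k] L →ₗ[k] L) (l x y : L) :
    TensorProduct.map bracket bracket (middleBraid X (comul l ⊗ₜ (x ⊗ₜ y))) =
      LinearMap.lTensor L bracket (TensorProduct.assoc k L L L
        (fundamentalBraidingOf X comul bracket (l ⊗ₜ x) ⊗ₜ y)) := by
  simp only [fundamentalBraidingOf, LinearMap.comp_apply, LinearMap.rTensor_tmul,
    LinearEquiv.coe_coe]
  induction comul l with
  | zero => simp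
  | add s t hs ht => simp only [TensorProduct.add_tmul, map_add, hs, ht]
  | tmul p q =>
    simp only [middleBraid, LinearMap.comp_apply, LinearEquiv.coe_coe, TensorProduct.assoc_tmul,
      LinearMap.lTensor_tmul, TensorProduct.assoc_symm_tmul, LinearMap.rTensor_tmul]
    induction X.braiding X (q ⊗ₜ x) with
    | zero => simp
    | add s t hs ht => simp only [TensorProduct.add_tmul, TensorProduct.tmul_add, map_add, hs, ht]
    | tmul p' q' => simp

end Braid

/-! ### Sums of matrix objects: bracket and inverse fundamental braiding. -/

/-- A crossed module `X` on `L` presented as a direct sum of matrix objects `V_s ⊗ V_s^♯`, where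
each crossed module `Y s` on `V_s` has a chosen finite homogeneous basis. -/
structure MatrixBlocks {k G L S : Type*} [Field k] [Group G] [Fintype G] [DecidableEq G]
    [AddCommGroup L] [Module k L] {V : S → Type*} [∀ s, AddCommGroup (V s)] [∀ s, Module k (V s)]
    (X : CrossedModule k G L) (Y : ∀ s, CrossedModule k G (V s)) (J : S → Type*) where
  basis : ∀ s, Module.Basis (J s) k (V s)
  deg : ∀ s, J s → G
  proj_basis : ∀ s i, (Y s).proj (deg s i) (basis s i) = basis s i
  inc : ∀ s, V s ⊗[k] Module.Dual k (V s) →ₗ[k] L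
  inc_isHom : ∀ s, ((Y s).tensor (Y s).dual).IsHom X (inc s)
  total : Module.Basis (Σ s, J s × J s) k L
  total_apply : ∀ s i j, total ⟨s, i, j⟩ = inc s (basis s i ⊗ₜ (basis s).coord j)

namespace MatrixBlocks

variable {k G L S N : Type*} [Field k] [Group G] [Fintype G] [DecidableEq G]
  [AddCommGroup L] [Module k L] [AddCommGroup N] [Module k N]
  {V : S → Type*} [∀ s, AddCommGroup (V s)] [∀ s, Module k (V s)]
  {X : CrossedModule k G L} {Y : ∀ s, CrossedModule k G (V s)} {J : S → Type*}
  (M : MatrixBlocks X Y J)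

theorem hom_ext {f g : L →ₗ[k] N}
    (h : ∀ s i j, f (M.inc s (M.basis s i ⊗ₜ (M.basis s).coord j)) =
      g (M.inc s (M.basis s i ⊗ₜ (M.basis s).coord j))) : f = g :=
  M.total.ext fun ⟨s, i, j⟩ => by rw [M.total_apply, h]

theorem hom_ext₂ {f g : L ⊗[k] L →ₗ[k] N}
    (h : ∀ s i j u x, X.proj u x = x →
      f (M.inc s (M.basis s i ⊗ₜ (M.basis s).coord j) ⊗ₜ x) =
        g (M.inc s (M.basis s i ⊗ₜ (M.basis s).coord j) ⊗ₜ x)) : f = g := by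
  have : TensorProduct.curry f = TensorProduct.curry g :=
    M.hom_ext fun s i j => X.hom_ext fun u x hx => h s i j u x hx
  exact TensorProduct.ext' fun l x => LinearMap.congr_fun₂ this l x

theorem hom_ext₃ {f g : L ⊗[k] (L ⊗[k] L) →ₗ[k] N}
    (h : ∀ s i j t i' j' u x, X.proj u x = x →
      f (M.inc s (M.basis s i ⊗ₜ (M.basis s).coord j) ⊗ₜ
        (M.inc t (M.basis t i' ⊗ₜ (M.basis t).coord j') ⊗ₜ x)) =
      g (M.inc s (M.basis s i ⊗ₜ (M.basis s).coord j) ⊗ₜ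
        (M.inc t (M.basis t i' ⊗ₜ (M.basis t).coord j') ⊗ₜ x))) : f = g := by
  have : TensorProduct.curry f = TensorProduct.curry g :=
    M.hom_ext fun s i j => M.hom_ext₂ fun t i' j' u x hx => h s i j t i' j' u x hx
  exact TensorProduct.ext' fun l x => LinearMap.congr_fun₂ this l x

theorem coord_comp_proj (s : S) (j : J s) :
    (M.basis s).coord j ∘ₗ (Y s).proj (M.deg s j) = (M.basis s).coord j := by
  classical
  refine (M.basis s).ext fun i => ?_
  rw [LinearMap.comp_apply, (Y s).proj_eq_ite (M.proj_basis s i)]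
  split_ifs with h
  · rfl
  · have : i ≠ j := fun hij => h (by rw [hij])
    simp [this]

theorem act_inc (s : S) (h : G) (v : V s) (φ : Module.Dual k (V s)) :
    X.act h (M.inc s (v ⊗ₜ φ)) = M.inc s ((Y s).act h v ⊗ₜ (φ ∘ₗ (Y s).act h⁻¹)) := by
  rw [← (M.inc_isHom s).act, CrossedModule.act_tmul, CrossedModule.dual_act_apply]

theorem proj_inc {s : S} {a b : G} {v : V s} {φ : Module.Dual k (V s)}
    (hv : (Y s).proj a v = v) (hφ : φ ∘ₗ (Y s).proj b = φ) :
    X.proj (a * b⁻¹) (M.inc s (v ⊗ₜ φ)) = M.inc s (v ⊗ₜ φ) :=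
  (M.inc_isHom s).proj ((Y s).proj_tmul _ hv ((Y s).dual_proj hφ))

theorem proj_generator (s : S) (i j : J s) :
    X.proj (M.deg s i * (M.deg s j)⁻¹) (M.inc s (M.basis s i ⊗ₜ (M.basis s).coord j)) =
      M.inc s (M.basis s i ⊗ₜ (M.basis s).coord j) :=
  M.proj_inc (M.proj_basis s i) (M.coord_comp_proj s j)

/-- The braided bracket, determined by `bracket_tmul`. -/
noncomputable def bracket : L ⊗[k] L →ₗ[k] L :=
  TensorProduct.lift (M.total.constr k fun p => ∑ u : G,
    ((M.basis p.1).coord p.2.2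
      ((Y p.1).act ((M.deg p.1 p.2.2)⁻¹ * u * M.deg p.1 p.2.2)⁻¹ (M.basis p.1 p.2.1))) •
        (X.act (M.deg p.1 p.2.2)⁻¹ ∘ₗ X.proj u))

theorem sum_inc_bilin {s : S} [Fintype (J s)] (v : V s) (φ : Module.Dual k (V s)) :
    M.inc s (v ⊗ₜ φ) = ∑ j, φ (M.basis s j) • M.inc s (v ⊗ₜ (M.basis s).coord j) := by
  conv_lhs => rw [← (M.basis s).sum_dual_apply_smul_coord φ]
  simp only [TensorProduct.tmul_sum, TensorProduct.tmul_smul, map_sum, map_smul]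

/-- The form of the bracket free of basis vectors, needed because the group action takes generators
to elements that are no longer generators. -/
theorem bracket_tmul {s : S} [Fintype (J s)] {b u : G} (v : V s) {φ : Module.Dual k (V s)} {x : L}
    (hφ : φ ∘ₗ (Y s).proj b = φ) (hx : X.proj u x = x) :
    M.bracket (M.inc s (v ⊗ₜ φ) ⊗ₜ x) = φ ((Y s).act (b⁻¹ * u * b)⁻¹ v) • X.act b⁻¹ x := by
  have key : ∀ j, M.bracket (M.inc s (v ⊗ₜ (M.basis s).coord j) ⊗ₜ x) =
      (M.basis s).coord j ((Y s).act ((M.deg s j)⁻¹ * u * M.deg s j)⁻¹ v) •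
        X.act (M.deg s j)⁻¹ x := by
    intro j
    have : M.bracket ∘ₗ (TensorProduct.mk k L L).flip x ∘ₗ M.inc s ∘ₗ
        (TensorProduct.mk k _ _).flip ((M.basis s).coord j) =
        ((M.basis s).coord j ∘ₗ (Y s).act ((M.deg s j)⁻¹ * u * M.deg s j)⁻¹).smulRight
          (X.act (M.deg s j)⁻¹ x) := by
      refine (M.basis s).ext fun i => ?_
      simp only [LinearMap.comp_apply, LinearMap.flip_apply, TensorProduct.mk_apply, bracket,
        TensorProduct.lift.tmul, ← M.total_apply, Module.Basis.constr_basis, LinearMap.sum_apply,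
        LinearMap.smul_apply, LinearMap.smulRight_apply]
      rw [Finset.sum_eq_single u]
      · rw [hx]
      · intro g _ hg
        rw [X.proj_of_ne hx hg]; simp
      · simp
    exact LinearMap.congr_fun this v
  rw [M.sum_inc_bilin, TensorProduct.sum_tmul, map_sum]
  conv_rhs => rw [← (M.basis s).sum_dual_apply_smul_coord φ, LinearMap.sum_apply, Finset.sum_smul]
  refine Finset.sum_congr rfl fun j _ => ?_
  rw [← TensorProduct.smul_tmul', map_smul, key, LinearMap.smul_apply, smul_assoc]
  -- Only dual basis vectors of the same degree as `φ` occur in its expansion, so the twist by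
  -- `M.deg s j` may be replaced by the twist by `b`.
  by_cases hj : b = M.deg s j
  · rw [hj]
  · have : φ (M.basis s j) = 0 := by
      rw [← hφ, LinearMap.comp_apply, (Y s).proj_of_ne (M.proj_basis s j) hj, map_zero]
    rw [this, zero_smul, zero_smul]

/-- The inverse of the fundamental braiding. -/
noncomputable def fundamentalBraidingInv : L ⊗[k] L →ₗ[k] L ⊗[k] L :=
  TensorProduct.lift (M.total.constr k fun p => ∑ u : G,
    TensorProduct.mk k L L (M.inc p.1 ((Y p.1).act u (M.basis p.1 p.2.1) ⊗ₜ
      (M.basis p.1).coord p.2.2)) ∘ₗ X.act (M.deg p.1 p.2.2) ∘ₗ X.proj u).flip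

theorem fundamentalBraidingInv_tmul {s : S} (v : V s) (j : J s) {u : G} {z : L}
    (hz : X.proj u z = z) :
    M.fundamentalBraidingInv (z ⊗ₜ M.inc s (v ⊗ₜ (M.basis s).coord j)) =
      M.inc s ((Y s).act u v ⊗ₜ (M.basis s).coord j) ⊗ₜ X.act (M.deg s j) z := by
  have : M.fundamentalBraidingInv ∘ₗ TensorProduct.mk k L L z ∘ₗ M.inc s ∘ₗ
      (TensorProduct.mk k _ _).flip ((M.basis s).coord j) =
      (TensorProduct.mk k L L).flip (X.act (M.deg s j) z) ∘ₗ M.inc s ∘ₗ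
      (TensorProduct.mk k _ _).flip ((M.basis s).coord j) ∘ₗ (Y s).act u := by
    refine (M.basis s).ext fun i => ?_
    simp only [LinearMap.comp_apply, LinearMap.flip_apply, TensorProduct.mk_apply,
      fundamentalBraidingInv, TensorProduct.lift.tmul, ← M.total_apply, Module.Basis.constr_basis,
      LinearMap.sum_apply]
    rw [Finset.sum_eq_single u]
    · rw [hz]
    · intro g _ hg
      rw [X.proj_of_ne hz hg]; simp
    · simp
  exact LinearMap.congr_fun this v

/-! ### The matrix coalgebra and the braided-Lie axioms. -/

variable [∀ s, Fintype (J s)]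

/-- The matrix coproduct. -/
noncomputable def comul : L →ₗ[k] L ⊗[k] L :=
  M.total.constr k fun p => ∑ i, M.total ⟨p.1, p.2.1, i⟩ ⊗ₜ M.total ⟨p.1, i, p.2.2⟩

/-- The matrix counit. -/
noncomputable def counit : L →ₗ[k] k :=
  M.total.constr k fun p => (M.basis p.1).coord p.2.2 (M.basis p.1 p.2.1)

theorem block_hom_ext {s : S} {f g : V s ⊗[k] Module.Dual k (V s) →ₗ[k] N}
    (h : ∀ i j, f (M.basis s i ⊗ₜ (M.basis s).coord j) =
      g (M.basis s i ⊗ₜ (M.basis s).coord j)) : f = g := by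
  classical
  refine ((M.basis s).tensorProduct (M.basis s).dualBasis).ext fun ⟨i, j⟩ => ?_
  simpa [← Module.Basis.coe_dualBasis] using h i j

theorem counit_inc (s : S) (v : V s) (φ : Module.Dual k (V s)) :
    M.counit (M.inc s (v ⊗ₜ φ)) = φ v := by
  have : M.counit ∘ₗ M.inc s = TensorProduct.lift (Module.Dual.eval k (V s)) := by
    refine M.block_hom_ext fun i j => ?_
    rw [LinearMap.comp_apply, ← M.total_apply, counit, Module.Basis.constr_basis]
    rfl
  exact LinearMap.congr_fun this (v ⊗ₜ φ)

theorem comul_inc (s : S) (v : V s) (φ : Module.Dual k (V s)) :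
    M.comul (M.inc s (v ⊗ₜ φ)) = ∑ i, M.inc s (v ⊗ₜ (M.basis s).coord i) ⊗ₜ[k]
      M.inc s (M.basis s i ⊗ₜ φ) := by
  have : M.comul ∘ₗ M.inc s = ∑ i, TensorProduct.map
      (M.inc s ∘ₗ (TensorProduct.mk k _ _).flip ((M.basis s).coord i))
      (M.inc s ∘ₗ TensorProduct.mk k _ _ (M.basis s i)) := by
    refine M.block_hom_ext fun i j => ?_
    rw [LinearMap.comp_apply, ← M.total_apply, comul, Module.Basis.constr_basis]
    simp [M.total_apply, LinearMap.sum_apply]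
  simpa [LinearMap.sum_apply] using LinearMap.congr_fun this (v ⊗ₜ φ)

/-- The coproduct inserts the canonical element in the middle. It is invariant, and the middle
degrees cancel in `(a c⁻¹)(c b⁻¹)`. -/
theorem comul_isHom : X.IsHom (X.tensor X) M.comul := by
  refine ⟨fun h => M.hom_ext fun s i j => ?_, fun g => M.hom_ext fun s i j => ?_⟩
  · simp only [LinearMap.comp_apply]
    rw [M.act_inc, M.comul_inc, M.comul_inc, map_sum]
    simp only [CrossedModule.act_tmul, M.act_inc]
    have key := (M.basis s).sum_coord_comp_symm ((Y s).act h) ((Y s).act h⁻¹)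
      (by ext x; simp)
      (LinearMap.mk₂ k (fun ψ w => M.inc s ((Y s).act h (M.basis s i) ⊗ₜ ψ) ⊗ₜ[k]
        M.inc s (w ⊗ₜ ((M.basis s).coord j ∘ₗ (Y s).act h⁻¹)))
        (by intros; simp only [TensorProduct.tmul_add, TensorProduct.add_tmul, map_add])
        (by intros; simp only [TensorProduct.tmul_smul, ← TensorProduct.smul_tmul', map_smul])
        (by intros; simp only [TensorProduct.tmul_add, TensorProduct.add_tmul, map_add])
        (by intros; simp only [TensorProduct.tmul_smul, ← TensorProduct.smul_tmul', map_smul]))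
    simp only [LinearMap.mk₂_apply] at key
    exact key.symm
  · simp only [LinearMap.comp_apply]
    rw [X.proj_eq_ite (M.proj_generator s i j)]
    rw [(X.tensor X).proj_eq_ite (h := M.deg s i * (M.deg s j)⁻¹)]
    · split_ifs <;> simp
    · rw [M.comul_inc, map_sum]
      refine Finset.sum_congr rfl fun l _ => ?_
      have := X.proj_tmul X (M.proj_generator s i l) (M.proj_generator s l j)
      simpa [mul_assoc] using this

theorem counit_isHom : X.IsHom (CrossedModule.unit k G) M.counit := by
  classical
  refine ⟨fun h => M.hom_ext fun s i j => ?_, fun g => M.hom_ext fun s i j => ?_⟩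
  · simp only [LinearMap.comp_apply]
    rw [M.act_inc, M.counit_inc, M.counit_inc]
    simp [CrossedModule.unit]
  · simp only [LinearMap.comp_apply]
    rw [X.proj_eq_ite (M.proj_generator s i j), apply_ite M.counit, M.counit_inc, map_zero]
    by_cases hij : i = j
    · subst hij
      by_cases hg : g = 1
      · simp [CrossedModule.unit, hg]
      · simp [CrossedModule.unit, hg, Ne.symm hg]
    · simp [hij]

theorem fundamentalBraiding_tmul {s : S} {b u : G} (v : V s) {φ : Module.Dual k (V s)} {x : L}
    (hφ : φ ∘ₗ (Y s).proj b = φ) (hx : X.proj u x = x) :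
    fundamentalBraidingOf X M.comul M.bracket (M.inc s (v ⊗ₜ φ) ⊗ₜ x) =
      X.act b⁻¹ x ⊗ₜ M.inc s ((Y s).act (b⁻¹ * u * b)⁻¹ v ⊗ₜ φ) := by
  simp only [fundamentalBraidingOf, LinearMap.comp_apply, LinearMap.rTensor_tmul,
    LinearEquiv.coe_coe, M.comul_inc, TensorProduct.sum_tmul, map_sum, TensorProduct.assoc_tmul,
    LinearMap.lTensor_tmul]
  have key : ∀ i, LinearMap.rTensor L M.bracket ((TensorProduct.assoc k L L L).symm
      (M.inc s (v ⊗ₜ (M.basis s).coord i) ⊗ₜ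
        X.braiding X (M.inc s (M.basis s i ⊗ₜ φ) ⊗ₜ x))) =
      X.act b⁻¹ x ⊗ₜ M.inc s (((M.basis s).coord i ((Y s).act (b⁻¹ * u * b)⁻¹ v) •
        M.basis s i) ⊗ₜ φ) := by
    intro i
    -- Braiding past `E_i ⊗ φ` acts on `x` by `deg i * b⁻¹`, and bracketing with `v ⊗ E^i` then acts
    -- by `(deg i)⁻¹`. The net action `b⁻¹` no longer depends on `i`, so the sum over `i`
    -- reassembles `w⁻¹ ▷ v`.
    rw [X.braiding_tmul X (M.proj_inc (M.proj_basis s i) hφ), TensorProduct.assoc_symm_tmul,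
      LinearMap.rTensor_tmul, M.bracket_tmul v (M.coord_comp_proj s i) (X.proj_act hx _),
      X.act_act, ← TensorProduct.smul_tmul', ← TensorProduct.smul_tmul', map_smul,
      TensorProduct.tmul_smul]
    congr 4 <;> group
  simp only [key]
  rw [← TensorProduct.tmul_sum, ← map_sum, ← TensorProduct.sum_tmul]
  congr 3
  exact (M.basis s).sum_repr _

theorem bracket_isHom : (X.tensor X).IsHom X M.bracket := by
  refine ⟨fun h => M.hom_ext₂ fun s i j u x hx => ?_, fun g => M.hom_ext₂ fun s i j u x hx => ?_⟩
  · have hj := M.coord_comp_proj s j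
    simp only [LinearMap.comp_apply, CrossedModule.act_tmul, M.act_inc]
    rw [M.bracket_tmul _ ((Y s).comp_act_comp_proj hj h) (X.proj_act hx h),
      M.bracket_tmul _ hj hx, map_smul, X.act_act, X.act_act, LinearMap.comp_apply,
      (Y s).act_act, (Y s).act_act]
    generalize M.deg s j = b
    have h1 : h⁻¹ * ((h * b * h⁻¹)⁻¹ * (h * u * h⁻¹) * (h * b * h⁻¹))⁻¹ * h =
        (b⁻¹ * u * b)⁻¹ := by group
    have h2 : (h * b * h⁻¹)⁻¹ * h = h * b⁻¹ := by group
    rw [h1, h2]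
  · have hj := M.coord_comp_proj s j
    simp only [LinearMap.comp_apply]
    rw [(X.tensor X).proj_eq_ite (X.proj_tmul X (M.proj_generator s i j) hx),
      apply_ite M.bracket, map_zero, M.bracket_tmul _ hj hx, map_smul]
    by_cases hne : (M.basis s).coord j
        ((Y s).act ((M.deg s j)⁻¹ * u * M.deg s j)⁻¹ (M.basis s i)) = 0
    · rw [hne, zero_smul, zero_smul, ite_self]
    · rw [(Y s).mul_eq_of_coeff_ne_zero (M.proj_basis s i) hj hne,
        X.proj_eq_ite (h := (M.deg s j)⁻¹ * u * M.deg s j)]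
      · split_ifs <;> simp
      · simpa using X.proj_act hx (M.deg s j)⁻¹

theorem jacobi : M.bracket ∘ₗ LinearMap.lTensor L M.bracket =
    M.bracket ∘ₗ TensorProduct.map M.bracket M.bracket ∘ₗ middleBraid X ∘ₗ
      LinearMap.rTensor (L ⊗[k] L) M.comul := by
  refine M.hom_ext₃ fun s i j t i' j' u x hx => ?_
  have hj := M.coord_comp_proj s j
  have hj' := M.coord_comp_proj t j'
  simp only [LinearMap.comp_apply, LinearMap.lTensor_tmul, LinearMap.rTensor_tmul]
  rw [map_bracket_middleBraid, M.fundamentalBraiding_tmul _ hj (M.proj_generator t i' j'),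
    TensorProduct.assoc_tmul, LinearMap.lTensor_tmul, M.bracket_tmul _ hj hx,
    M.bracket_tmul _ hj' hx, TensorProduct.tmul_smul, TensorProduct.tmul_smul, map_smul, map_smul,
    ← X.act_tmul X, M.bracket_isHom.act, M.bracket_tmul _ hj' hx,
    M.bracket_tmul _ hj (X.proj_act hx _), map_smul, smul_smul, smul_smul, X.act_act,
    (Y s).act_act, mul_comm]
  -- Both sides now carry the coefficient of the inner bracket. Where it is nonzero, the degree of
  -- that bracket is the product of the degrees of its arguments, which identifies the two twists of
  -- the outer left vector.
  by_cases hne : (M.basis t).coord j'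
      ((Y t).act ((M.deg t j')⁻¹ * u * M.deg t j')⁻¹ (M.basis t i')) = 0
  · simp only [hne, mul_zero]
  · have h := (Y t).mul_eq_of_coeff_ne_zero (M.proj_basis t i') hj' hne
    generalize M.deg s j = b at *
    generalize M.deg t j' = b' at *
    generalize M.deg t i' = a' at *
    have h' : (b⁻¹ * u * b)⁻¹ * (b⁻¹ * (a' * b'⁻¹) * b)⁻¹ =
        (b⁻¹ * (b'⁻¹ * u * b'⁻¹⁻¹) * b)⁻¹ := by
      rw [inv_inv b', ← h]
      group
    rw [h', mul_comm]

theorem cocomm : LinearMap.lTensor L M.bracket ∘ₗ (TensorProduct.assoc k L L L).toLinearMap ∘ₗ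
      LinearMap.rTensor L M.comul =
    X.braiding X ∘ₗ fundamentalBraidingOf X M.comul M.bracket := by
  refine M.hom_ext₂ fun s i j u x hx => ?_
  have hj := M.coord_comp_proj s j
  have hx' : X.proj ((M.deg s j)⁻¹ * u * M.deg s j) (X.act (M.deg s j)⁻¹ x) =
      X.act (M.deg s j)⁻¹ x := by
    simpa using X.proj_act hx (M.deg s j)⁻¹
  simp only [LinearMap.comp_apply, LinearMap.rTensor_tmul, LinearEquiv.coe_coe]
  -- The outer braiding acts by `w`: it cancels the twist `w⁻¹` on the vector and moves it to the
  -- functional, whose dual basis coefficients are those of the brackets on the left side.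
  rw [M.fundamentalBraiding_tmul _ hj hx, X.braiding_tmul X hx', M.act_inc, (Y s).act_act,
    mul_inv_cancel, (Y s).act_one, M.sum_inc_bilin _ (_ ∘ₗ _), M.comul_inc,
    TensorProduct.sum_tmul, TensorProduct.sum_tmul, map_sum, map_sum]
  refine Finset.sum_congr rfl fun l _ => ?_
  rw [TensorProduct.assoc_tmul, LinearMap.lTensor_tmul, M.bracket_tmul _ hj hx,
    TensorProduct.tmul_smul, TensorProduct.smul_tmul']
  rfl

/-- The action on `L ⊗ L` through the coproduct obeys the same formula as the bracket. For `t = x ⊗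
y` the two successive twists of `v` multiply to the one given by the total degree. -/
theorem map_bracket_tensor {s : S} {b u : G} (v : V s) {φ : Module.Dual k (V s)} {t : L ⊗[k] L}
    (hφ : φ ∘ₗ (Y s).proj b = φ) (ht : (X.tensor X).proj u t = t) :
    TensorProduct.map M.bracket M.bracket (middleBraid X (M.comul (M.inc s (v ⊗ₜ φ)) ⊗ₜ t)) =
      φ ((Y s).act (b⁻¹ * u * b)⁻¹ v) • (X.tensor X).act b⁻¹ t := by
  have key : TensorProduct.map M.bracket M.bracket ∘ₗ middleBraid X ∘ₗ
      TensorProduct.mk k _ _ (M.comul (M.inc s (v ⊗ₜ φ))) ∘ₗ (X.tensor X).proj u =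
      φ ((Y s).act (b⁻¹ * u * b)⁻¹ v) • ((X.tensor X).act b⁻¹ ∘ₗ (X.tensor X).proj u) := by
    refine TensorProduct.ext' fun x y => ?_
    have hproj : (X.tensor X).proj u (x ⊗ₜ y) = ∑ a, X.proj a x ⊗ₜ X.proj (a⁻¹ * u) y := by
      simp [CrossedModule.tensor, LinearMap.sum_apply]
    simp only [LinearMap.comp_apply, LinearMap.smul_apply, hproj, map_sum, TensorProduct.mk_apply,
      Finset.smul_sum]
    refine Finset.sum_congr rfl fun a _ => ?_
    rw [map_bracket_middleBraid, M.fundamentalBraiding_tmul v hφ (u := a) (by simp [X.proj_proj]),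
      TensorProduct.assoc_tmul, LinearMap.lTensor_tmul,
      M.bracket_tmul _ hφ (u := a⁻¹ * u) (by simp [X.proj_proj]), (Y s).act_act,
      TensorProduct.tmul_smul, CrossedModule.act_tmul]
    congr 4
    group
  have := LinearMap.congr_fun key t
  simpa only [LinearMap.comp_apply, ht, LinearMap.smul_apply, TensorProduct.mk_apply] using this

theorem comul_bracket : M.comul ∘ₗ M.bracket =
    TensorProduct.map M.bracket M.bracket ∘ₗ middleBraid X ∘ₗ
      TensorProduct.map M.comul M.comul := by
  refine M.hom_ext₂ fun s i j u x hx => ?_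
  have hj := M.coord_comp_proj s j
  simp only [LinearMap.comp_apply, TensorProduct.map_tmul]
  rw [M.map_bracket_tensor _ hj (M.comul_isHom.proj hx), M.bracket_tmul _ hj hx, map_smul,
    M.comul_isHom.act]

theorem counit_bracket : M.counit ∘ₗ M.bracket =
    (TensorProduct.lid k k).toLinearMap ∘ₗ TensorProduct.map M.counit M.counit := by
  refine M.hom_ext₂ fun s i j u x hx => ?_
  have hj := M.coord_comp_proj s j
  simp only [LinearMap.comp_apply, TensorProduct.map_tmul, LinearEquiv.coe_coe,
    TensorProduct.lid_tmul]
  rw [M.bracket_tmul _ hj hx, map_smul, M.counit_isHom.act, M.counit_inc]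
  -- In degree `1` the twist of the vector is trivial; in any other degree the counit vanishes.
  by_cases hu : u = 1
  · simp [hu, CrossedModule.unit]
  · have : M.counit x = 0 := by
      have := M.counit_isHom.proj hx
      simpa [CrossedModule.unit, hu, eq_comm] using this
    simp [this]

/-- The left braided-Lie algebra on a sum of matrix objects. -/
noncomputable def algebra : LeftBraidedLieAlgebra X where
  comul := M.comul
  counit := M.counit
  coassoc := M.hom_ext fun s i j => by
    simp only [LinearMap.comp_apply, M.comul_inc, map_sum, LinearMap.rTensor_tmul,
      LinearMap.lTensor_tmul, TensorProduct.sum_tmul, TensorProduct.tmul_sum, LinearEquiv.coe_coe,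
      TensorProduct.assoc_tmul]
    exact Finset.sum_comm
  rTensor_counit_comp_comul := M.hom_ext fun s i j => by
    classical
    simp only [LinearMap.comp_apply, M.comul_inc, map_sum, LinearMap.rTensor_tmul, M.counit_inc,
      TensorProduct.mk_apply, Module.Basis.coord_apply, Module.Basis.repr_self]
    rw [Finset.sum_eq_single i]
    · simp
    · intro l _ hl
      simp [hl]
    · simp
  lTensor_counit_comp_comul := M.hom_ext fun s i j => by
    classical
    simp only [LinearMap.comp_apply, M.comul_inc, map_sum, LinearMap.lTensor_tmul, M.counit_inc,
      LinearMap.flip_apply, TensorProduct.mk_apply, Module.Basis.coord_apply,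
      Module.Basis.repr_self]
    rw [Finset.sum_eq_single j]
    · simp
    · intro l _ hl
      simp [hl.symm]
    · simp
  bracket := M.bracket
  comul_isHom := M.comul_isHom
  counit_isHom := M.counit_isHom
  bracket_isHom := M.bracket_isHom
  jacobi := M.jacobi
  cocomm := M.cocomm
  comul_bracket := M.comul_bracket
  counit_bracket := M.counit_bracket

theorem algebra_isRegular : M.algebra.IsRegular := by
  refine Function.bijective_iff_has_inverse.2 ⟨M.fundamentalBraidingInv, fun t => ?_, fun t => ?_⟩
  · refine LinearMap.congr_fun (f := M.fundamentalBraidingInv ∘ₗ M.algebra.fundamentalBraiding)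
      (g := LinearMap.id) (M.hom_ext₂ fun s i j u x hx => ?_) t
    have hx' : X.proj ((M.deg s j)⁻¹ * u * M.deg s j) (X.act (M.deg s j)⁻¹ x) =
        X.act (M.deg s j)⁻¹ x := by
      simpa using X.proj_act hx (M.deg s j)⁻¹
    rw [LinearMap.comp_apply]
    change M.fundamentalBraidingInv (fundamentalBraidingOf X M.comul M.bracket _) = _
    rw [M.fundamentalBraiding_tmul _ (M.coord_comp_proj s j) hx,
      M.fundamentalBraidingInv_tmul _ _ hx', (Y s).act_act, X.act_act, mul_inv_cancel,
      mul_inv_cancel, (Y s).act_one, X.act_one, LinearMap.id_apply]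
  · refine LinearMap.congr_fun (f := M.algebra.fundamentalBraiding ∘ₗ M.fundamentalBraidingInv)
      (g := LinearMap.id) ?_ t
    have : TensorProduct.curry (M.algebra.fundamentalBraiding ∘ₗ M.fundamentalBraidingInv) =
        TensorProduct.curry LinearMap.id := by
      refine X.hom_ext fun u x hx => M.hom_ext fun s i j => ?_
      simp only [TensorProduct.curry_apply, LinearMap.comp_apply, LinearMap.id_apply]
      rw [M.fundamentalBraidingInv_tmul _ _ hx]
      change fundamentalBraidingOf X M.comul M.bracket _ = _
      rw [M.fundamentalBraiding_tmul _ (M.coord_comp_proj s j) (X.proj_act hx _), X.act_act,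
        (Y s).act_act, inv_mul_cancel, X.act_one]
      congr 3
      have : ((M.deg s j)⁻¹ * (M.deg s j * u * (M.deg s j)⁻¹) * M.deg s j)⁻¹ * u = 1 := by group
      rw [this, (Y s).act_one]
    exact TensorProduct.ext' fun l x => LinearMap.congr_fun₂ this l x

end MatrixBlocks

/-! ### Identity matrices and units. -/

namespace MatrixBlocks

variable {k G L S : Type*} [Field k] [Group G] [Fintype G] [DecidableEq G]
  [AddCommGroup L] [Module k L]
  {V : S → Type*} [∀ s, AddCommGroup (V s)] [∀ s, Module k (V s)]
  {X : CrossedModule k G L} {Y : ∀ s, CrossedModule k G (V s)} {J : S → Type*}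
  (M : MatrixBlocks X Y J) [∀ s, Fintype (J s)]

/-- The identity matrix of the block `s`. -/
noncomputable def one (s : S) : L := ∑ i, M.inc s (M.basis s i ⊗ₜ (M.basis s).coord i)

theorem act_one (s : S) (h : G) : X.act h (M.one s) = M.one s := by
  have key := (M.basis s).sum_coord_comp_symm ((Y s).act h) ((Y s).act h⁻¹)
    (by ext x; simp)
    (LinearMap.mk₂ k (fun ψ w => M.inc s (w ⊗ₜ ψ))
      (by intros; simp only [TensorProduct.tmul_add, map_add])
      (by intros; simp only [TensorProduct.tmul_smul, map_smul])
      (by intros; simp only [TensorProduct.add_tmul, map_add])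
      (by intros; simp only [← TensorProduct.smul_tmul', map_smul]))
  simp only [LinearMap.mk₂_apply] at key
  rw [one, map_sum, ← key]
  exact Finset.sum_congr rfl fun i _ => M.act_inc s h _ _

theorem proj_one (s : S) : X.proj 1 (M.one s) = M.one s := by
  rw [one, map_sum]
  refine Finset.sum_congr rfl fun i _ => ?_
  simpa using M.proj_generator s i i

/-- The identity matrix is invariant of degree `1`, so both twists in the bracket disappear. This
half of (L4) needs no condition on the dimension. -/
theorem bracket_one (s : S) (x : L) : M.bracket (x ⊗ₜ M.one s) = M.counit x • M.one s := by
  have : M.bracket ∘ₗ (TensorProduct.mk k L L).flip (M.one s) =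
      M.counit.smulRight (M.one s) := by
    refine M.hom_ext fun t i j => ?_
    simp only [LinearMap.comp_apply, LinearMap.flip_apply, TensorProduct.mk_apply,
      LinearMap.smulRight_apply]
    rw [M.bracket_tmul _ (M.coord_comp_proj t j) (M.proj_one s), M.act_one, M.counit_inc]
    simp
  exact LinearMap.congr_fun this x

theorem isUnitMap_one (s : S) [Unique (J s)] (h : ∀ x, M.bracket (M.one s ⊗ₜ x) = x) :
    M.algebra.IsUnitMap (LinearMap.toSpanSingleton k L (M.one s)) where
  isHom := by
    refine ⟨fun h => LinearMap.ext_ring ?_, fun g => LinearMap.ext_ring ?_⟩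
    · simp [CrossedModule.unit, M.act_one]
    · rw [LinearMap.comp_apply, LinearMap.comp_apply, LinearMap.toSpanSingleton_apply_one,
        X.proj_eq_ite (M.proj_one s)]
      by_cases hg : g = 1
      · simp [CrossedModule.unit, hg]
      · simp [CrossedModule.unit, hg, Ne.symm hg]
  comul_unit := by
    change M.comul _ = _
    simp [one, M.comul_inc]
  counit_unit := by
    change M.counit _ = _
    simp [one, M.counit_inc]
  unit_bracket x := by
    rw [LinearMap.toSpanSingleton_apply_one]
    exact h x
  bracket_unit x := by
    rw [LinearMap.toSpanSingleton_apply_one]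
    exact M.bracket_one s x

theorem bracket_one_of_trivial (s : S) [Unique (J s)] (hdeg : M.deg s default = 1)
    (hact : ∀ h v, (Y s).act h v = v) (x : L) : M.bracket (M.one s ⊗ₜ x) = x := by
  have : M.bracket ∘ₗ TensorProduct.mk k L L (M.one s) = LinearMap.id := by
    refine X.hom_ext fun u x hx => ?_
    rw [LinearMap.comp_apply, TensorProduct.mk_apply, one, Fintype.sum_unique,
      M.bracket_tmul _ (M.coord_comp_proj s default) hx, hact, hdeg]
    simp
  exact LinearMap.congr_fun this x

end MatrixBlocks

namespace MatrixBlocks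

variable {k G L V J : Type*} [Field k] [Group G] [Fintype G] [DecidableEq G]
  [AddCommGroup L] [Module k L] [AddCommGroup V] [Module k V]
  {X : CrossedModule k G L} {Y : CrossedModule k G V}
  (M : MatrixBlocks X (fun _ : Unit => Y) (fun _ => J)) [Fintype J]

theorem bracket_one_of_unique [Unique J] (x : L) : M.bracket (M.one () ⊗ₜ x) = x := by
  have h1 : M.one () = M.inc () (M.basis () default ⊗ₜ (M.basis ()).coord default) := by
    simp [one]
  have : M.bracket ∘ₗ TensorProduct.mk k L L (M.one ()) = LinearMap.id := by
    refine M.hom_ext fun s i j => ?_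
    obtain rfl := Unique.eq_default i
    obtain rfl := Unique.eq_default j
    change M.bracket (M.one () ⊗ₜ _) = _
    rw [← h1]
    nth_rw 1 [h1]
    rw [M.bracket_tmul _ (M.coord_comp_proj () default) (M.proj_one ()), M.act_one]
    simp
  exact LinearMap.congr_fun this x

/-- The coordinates of `e` multiply like matrix units and have trace `1`, so some diagonal
coordinate `e_ii` is nonzero. For `l ≠ i`, the relation `e_il * e_ii = 0` gives `e_il = 0`,
contradicting `e_il * e_li = e_ii`. -/
theorem card_eq_one_of_grouplike {e : L} (hcomul : M.comul e = e ⊗ₜ e) (hcounit : M.counit e = 1) :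
    Fintype.card J = 1 := by
  classical
  have hsplit : ∀ i j j' l, M.total.coord ⟨(), i, j⟩ e * M.total.coord ⟨(), j', l⟩ e =
      if j = j' then M.total.coord ⟨(), i, l⟩ e else 0 := by
    intro i j j' l
    have : LinearMap.mul' k k ∘ₗ TensorProduct.map (M.total.coord ⟨(), i, j⟩)
        (M.total.coord ⟨(), j', l⟩) ∘ₗ M.comul =
        if j = j' then M.total.coord ⟨(), i, l⟩ else 0 := by
      refine M.total.ext fun ⟨_, a, b⟩ => ?_
      rw [comul, LinearMap.comp_apply, LinearMap.comp_apply, Module.Basis.constr_basis]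
      simp only [map_sum, TensorProduct.map_tmul, LinearMap.mul'_apply, Module.Basis.coord_apply,
        Module.Basis.repr_self, Finsupp.single_apply, Sigma.mk.injEq, heq_eq_eq, Prod.mk.injEq,
        true_and]
      rw [Finset.sum_eq_single j]
      · split_ifs <;> simp_all
      · intro c _ hc
        simp [hc]
      · simp
    have := LinearMap.congr_fun this e
    rw [LinearMap.comp_apply, LinearMap.comp_apply, hcomul, TensorProduct.map_tmul,
      LinearMap.mul'_apply] at this
    rw [this]
    split_ifs <;> rfl
  have htrace : ∑ i, M.total.coord ⟨(), i, i⟩ e = 1 := by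
    rw [← hcounit]
    have : ∑ i, M.total.coord ⟨(), i, i⟩ = M.counit := by
      refine M.total.ext fun ⟨_, a, b⟩ => ?_
      rw [counit, Module.Basis.constr_basis]
      simp only [LinearMap.sum_apply, Module.Basis.coord_apply,
        Module.Basis.repr_self, Finsupp.single_apply, Sigma.mk.injEq, heq_eq_eq, Prod.mk.injEq,
        true_and]
      rw [Finset.sum_eq_single a]
      · simp [eq_comm]
      · intro c _ hc
        simp [hc.symm]
      · simp
    rw [← this, LinearMap.sum_apply]
  obtain ⟨i, hi⟩ : ∃ i, M.total.coord ⟨(), i, i⟩ e ≠ 0 := by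
    by_contra! h
    simp [h] at htrace
  refine Fintype.card_eq_one_iff.2 ⟨i, fun l => ?_⟩
  by_contra hl
  have h1 := hsplit i l i i
  have h2 := hsplit i l l i
  rw [if_neg hl] at h1
  rw [if_pos rfl] at h2
  rcases mul_eq_zero.1 h1 with h | h
  · rw [h, zero_mul] at h2
    exact hi h2.symm
  · exact hi h

theorem algebra_isUnital_iff : M.algebra.IsUnital ↔ Fintype.card J = 1 := by
  constructor
  · rintro ⟨η, hη⟩
    exact M.card_eq_one_of_grouplike hη.comul_unit hη.counit_unit
  · intro h
    obtain ⟨i, hi⟩ := Fintype.card_eq_one_iff.1 h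
    let : Unique J := ⟨⟨i⟩, hi⟩
    exact ⟨_, M.isUnitMap_one () fun x => M.bracket_one_of_unique x⟩

end MatrixBlocks

/-! ### Bases and matrix coefficients of `V_{𝒞,π}` and of direct sums. -/

theorem DFinsupp.basis_apply {S R : Type*} [DecidableEq S] [Semiring R] {M : S → Type*}
    [∀ s, AddCommMonoid (M s)] [∀ s, Module R (M s)] {η : S → Type*}
    (b : ∀ s, Module.Basis (η s) R (M s)) (s : S) (p : η s) :
    DFinsupp.basis b ⟨s, p⟩ = DFinsupp.single s (b s p) := by
  apply (DFinsupp.basis b).repr.injective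
  rw [Module.Basis.repr_self]
  simp only [DFinsupp.basis, LinearEquiv.trans_apply, DFinsupp.mapRange.linearEquiv_apply,
    DFinsupp.mapRange_single, Module.Basis.repr_self]
  rw [LinearEquiv.eq_symm_apply]
  exact sigmaFinsuppEquivDFinsupp_single _ _

namespace BasedClass

variable {G : Type*} [Group G] (D : BasedClass G)

theorem zeta_conj_inv (b : D.cls) (h : G) :
    D.zeta (D.conj h b) h⁻¹ = (D.zeta b h)⁻¹ := by
  rw [eq_inv_iff_mul_eq_one, ← D.zeta_mul, inv_mul_cancel, D.zeta_one]

theorem conj_inv_eq_iff (h : G) (a b : D.cls) : D.conj h⁻¹ a = b ↔ a = D.conj h b := by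
  constructor
  · rintro rfl
    rw [← D.conj_mul, mul_inv_cancel, D.conj_one]
  · rintro rfl
    rw [← D.conj_mul, inv_mul_cancel, D.conj_one]

end BasedClass

section BlockBasis

variable {k G W : Type*} [Field k] [Group G] [AddCommGroup W] [Module k W] {I : Type*}
  (D : BasedClass G) (v : Module.Basis I k W)

/-- The basis `E_{ai}` of `V_{𝒞,π}`. -/
noncomputable def blockBasis : Module.Basis (Σ _ : D.cls, I) k (BlockV D W) :=
  Finsupp.basis fun _ => v

theorem blockBasis_apply (a : D.cls) (i : I) : blockBasis D v ⟨a, i⟩ = vecE D v a i := by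
  simp [blockBasis, vecE]

theorem blockBasis_coord (b : D.cls) (j : I) : (blockBasis D v).coord ⟨b, j⟩ = covecE D v b j := rfl

theorem covecE_single [DecidableEq G] [DecidableEq I] (b : D.cls) (j : I) (a : D.cls) (w : W) :
    covecE D v b j (Finsupp.single a w) = if a = b then v.repr w j else 0 := by
  simp only [covecE, LinearMap.comp_apply, Finsupp.lapply_apply, Finsupp.single_apply]
  split_ifs <;> simp

theorem covecE_vecE [DecidableEq G] [DecidableEq I] (b : D.cls) (j : I) (a : D.cls) (i : I) :
    covecE D v b j (vecE D v a i) = if a = b ∧ i = j then 1 else 0 := by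
  rw [vecE, covecE_single, Module.Basis.repr_self, Finsupp.single_apply, ite_and]

end BlockBasis

section Block

variable {k G W : Type*} [Field k] [Group G] [Fintype G] [DecidableEq G]
  [AddCommGroup W] [Module k W] {I : Type*} (D : BasedClass G)
  (π : Representation k D.isotropy W) (v : Module.Basis I k W)

theorem blockCrossed_proj_vecE (a : D.cls) (i : I) (g : G) :
    (blockCrossed D π).proj g (vecE D v a i) = if (a : G) = g then vecE D v a i else 0 := by
  simp only [blockCrossed, vecE, Finsupp.lsum_single]
  split_ifs <;> rfl

theorem blockCrossed_act_single (h : G) (a : D.cls) (w : W) :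
    (blockCrossed D π).act h (Finsupp.single a w) =
      Finsupp.single (D.conj h a) (π (D.zeta a h) w) := by
  simp [blockCrossed]

theorem blockCrossed_act_vecE [Fintype I] (h : G) (a : D.cls) (i : I) :
    (blockCrossed D π).act h (vecE D v a i) =
      ∑ x, matrixCoeff π v (D.zeta a h) x i • vecE D v (D.conj h a) x := by
  rw [vecE, blockCrossed_act_single]
  conv_lhs => rw [← v.sum_repr (π (D.zeta a h) (v i)), ← Finsupp.lsingle_apply (R := k), map_sum]
  simp [matrixCoeff, vecE]

theorem covecE_act_vecE [DecidableEq I] (h : G) (b : D.cls) (j : I) (a : D.cls) (i : I) :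
    covecE D v b j ((blockCrossed D π).act h (vecE D v a i)) =
      if D.conj h a = b then matrixCoeff π v (D.zeta a h) j i else 0 := by
  rw [vecE, blockCrossed_act_single, covecE_single]
  rfl

/-- Only vectors over `a = hbh⁻¹` pair nontrivially, and there the cocycle identity turns `ζ_a(h⁻¹)`
into `ζ_b(h)⁻¹`. -/
theorem covecE_comp_act [Fintype I] [DecidableEq I] (h : G) (b : D.cls) (j : I) :
    covecE D v b j ∘ₗ (blockCrossed D π).act h⁻¹ =
      ∑ y, matrixCoeff π v (D.zeta b h)⁻¹ j y • covecE D v (D.conj h b) y := by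
  refine (blockBasis D v).ext fun ⟨a, i⟩ => ?_
  rw [blockBasis_apply, LinearMap.comp_apply, covecE_act_vecE, LinearMap.sum_apply]
  simp only [D.conj_inv_eq_iff, LinearMap.smul_apply, covecE_vecE, smul_eq_mul]
  split_ifs with hab
  · subst hab
    simp [D.zeta_conj_inv]
  · simp [hab]

theorem covecE_act_vecE_of_degree [DecidableEq I] (u : G) (b : D.cls) (j : I) (a : D.cls) (i : I) :
    covecE D v b j ((blockCrossed D π).act ((b : G)⁻¹ * u * b)⁻¹ (vecE D v a i)) =
      if (a : G) * (b : G)⁻¹ * u = (b : G)⁻¹ * u * b then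
        matrixCoeff π v (D.zeta a ((b : G)⁻¹ * u * b)⁻¹) j i else 0 := by
  rw [covecE_act_vecE]
  refine if_congr ?_ rfl rfl
  rw [D.conj_inv_eq_iff, Subtype.ext_iff]
  change (a : G) = ((b : G)⁻¹ * u * b) * b * ((b : G)⁻¹ * u * b)⁻¹ ↔ _
  -- With `w = b⁻¹ub`, right multiplication of `a = wbw⁻¹` by `b⁻¹u` gives the degree condition
  -- `ab⁻¹u = w` of the bracket formula.
  rw [← mul_left_inj ((b : G)⁻¹ * u)]
  simp [mul_assoc]

theorem blockEndCrossed_act_matE [Fintype I] [DecidableEq I] (h : G) (a : D.cls) (i : I)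
    (b : D.cls) (j : I) :
    (blockEndCrossed D π).act h (matE D v a i b j) =
      ∑ x, ∑ y, (matrixCoeff π v (D.zeta a h) x i * matrixCoeff π v (D.zeta b h)⁻¹ j y) •
        matE D v (D.conj h a) x (D.conj h b) y := by
  rw [blockEndCrossed, matE, CrossedModule.act_tmul, CrossedModule.dual_act_apply,
    blockCrossed_act_vecE, covecE_comp_act, TensorProduct.sum_tmul]
  simp only [TensorProduct.tmul_sum, TensorProduct.smul_tmul_smul]
  rfl

/-- The basis `E_{ai}^{bj}` of `End(V_{𝒞,π})`. -/
noncomputable def blockEndBasis [Fintype I] :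
    Module.Basis ((Σ _ : D.cls, I) × (Σ _ : D.cls, I)) k (BlockEnd k D W) :=
  haveI := Classical.decEq I
  (blockBasis D v).tensorProduct (blockBasis D v).dualBasis

theorem blockEndBasis_apply [Fintype I] (p q : Σ _ : D.cls, I) :
    blockEndBasis D v (p, q) = blockBasis D v p ⊗ₜ (blockBasis D v).coord q := by
  simp [blockEndBasis]

/-- A block as a one-term sum of matrix objects. -/
noncomputable def blockMatrix [Fintype I] : MatrixBlocks (blockEndCrossed D π)
    (fun _ : Unit => blockCrossed D π) (fun _ => Σ _ : D.cls, I) where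
  basis _ := blockBasis D v
  deg _ p := p.1
  proj_basis := fun _ ⟨a, i⟩ => by
    rw [blockBasis_apply, blockCrossed_proj_vecE, if_pos rfl]
  inc _ := LinearMap.id
  inc_isHom _ := ⟨fun _ => rfl, fun _ => rfl⟩
  total := (blockEndBasis D v).reindex (Equiv.uniqueSigma fun _ : Unit => _).symm
  total_apply := fun _ p q => by
    rw [Module.Basis.reindex_apply, Equiv.symm_symm]
    exact blockEndBasis_apply D v p q

theorem blockEndCrossed_proj_matE [Fintype I] (g : G) (a : D.cls) (i : I) (b : D.cls) (j : I) :
    (blockEndCrossed D π).proj g (matE D v a i b j) =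
      if (a : G) * (b : G)⁻¹ = g then matE D v a i b j else 0 := by
  have := (blockMatrix D π v).proj_generator () ⟨a, i⟩ ⟨b, j⟩
  simp only [blockMatrix, blockBasis_apply, blockBasis_coord] at this
  exact CrossedModule.proj_eq_ite _ this g

end Block

section Sum

variable {k G S : Type*} [Field k] [Group G] [Fintype G] [DecidableEq G] [DecidableEq S]
  (D : S → BasedClass G) {W : S → Type*} [∀ s, AddCommGroup (W s)] [∀ s, Module k (W s)]
  (π : ∀ s, Representation k (D s).isotropy (W s))
  {I : S → Type*} [∀ s, Fintype (I s)] (v : ∀ s, Module.Basis (I s) k (W s))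

/-- A direct sum of blocks as a sum of matrix objects. -/
noncomputable def sumMatrix : MatrixBlocks
    (CrossedModule.directSum fun s => blockEndCrossed (D s) (π s))
    (fun s => blockCrossed (D s) (π s)) (fun s => Σ _ : (D s).cls, I s) where
  basis s := blockBasis (D s) (v s)
  deg _ p := p.1
  proj_basis := fun _ ⟨a, i⟩ => by
    rw [blockBasis_apply, blockCrossed_proj_vecE, if_pos rfl]
  inc s := DirectSum.lof k S (fun s => BlockEnd k (D s) (W s)) s
  inc_isHom s :=
    ⟨fun h => LinearMap.ext fun x =>
      (DirectSum.lmap_lof (fun s => (blockEndCrossed (D s) (π s)).act h) s x).symm,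
    fun g => LinearMap.ext fun x =>
      (DirectSum.lmap_lof (fun s => (blockEndCrossed (D s) (π s)).proj g) s x).symm⟩
  total := DFinsupp.basis fun s => blockEndBasis (D s) (v s)
  total_apply := fun s p q => by
    rw [DFinsupp.basis_apply, blockEndBasis_apply]
    rfl

end Sum

/-! ### The proposition, for single blocks and for sums. -/

theorem mainTheorem2 {k G : Type*} [Field k] [Group G] [Fintype G] [DecidableEq G]
    {S : Type*} [DecidableEq S] (D : S → BasedClass G)
    {W : S → Type*} [∀ s, AddCommGroup (W s)] [∀ s, Module k (W s)]
    (π : ∀ s, Representation k (D s).isotropy (W s))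
    {I : S → Type*} [∀ s, Fintype (I s)] [∀ s, DecidableEq (I s)]
    (v : ∀ s, Module.Basis (I s) k (W s)) :
    -- each single block
    (∀ s,
      let D := D s
      let π := π s
      let X := blockEndCrossed D π
      let E := matE D (v s)
      let m := matrixCoeff π (v s)
      -- the crossed module structure on the basis
      (∀ h a i b j, X.act h (E a i b j) =
        ∑ x, ∑ y, (m (D.zeta a h) x i * m (D.zeta b h)⁻¹ j y) •
          E (D.conj h a) x (D.conj h b) y) ∧
      (∀ g a i b j, X.proj g (E a i b j) =
        if (a : G) * (b : G)⁻¹ = g then E a i b j else 0) ∧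
      ∃ A : LeftBraidedLieAlgebra X,
        (∀ a i b j, A.comul (E a i b j) = ∑ c, ∑ l, E a i c l ⊗ₜ[k] E c l b j) ∧
        (∀ a i b j, A.counit (E a i b j) = if a = b ∧ i = j then 1 else 0) ∧
        (∀ (a : D.cls) i (b : D.cls) j (c : D.cls) x (d : D.cls) y,
          -- the degree of `b⁻¹ ▷ E_{cx}^{dy}`
          let w : G := (b : G)⁻¹ * ((c : G) * (d : G)⁻¹) * b
          A.bracket (E a i b j ⊗ₜ[k] E c x d y) =
            if ((a : G) * (b : G)⁻¹) * ((c : G) * (d : G)⁻¹) = w then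
              m (D.zeta a w⁻¹) j i • X.act (b : G)⁻¹ (E c x d y)
            else 0) ∧
        (∀ (a : D.cls) i (b : D.cls) j (c : D.cls) x (d : D.cls) y,
          let w : G := (b : G)⁻¹ * ((c : G) * (d : G)⁻¹) * b
          A.fundamentalBraiding (E a i b j ⊗ₜ[k] E c x d y) =
            X.act (b : G)⁻¹ (E c x d y) ⊗ₜ[k]
              ((blockCrossed D π).act w⁻¹ (vecE D (v s) a i) ⊗ₜ[k] covecE D (v s) b j)) ∧
        A.IsRegular ∧
        (A.IsUnital ↔ Module.finrank k (BlockV D (W s)) = 1)) ∧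
    -- direct sums of blocks
    (let X := CrossedModule.directSum fun s => blockEndCrossed (D s) (π s)
      let inc := DirectSum.lof k S fun s => BlockEnd k (D s) (W s)
      let E := fun s a i b j => inc s (matE (D s) (v s) a i b j)
      let m := fun s => matrixCoeff (π s) (v s)
      ∃ A : LeftBraidedLieAlgebra X,
        (∀ s a i b j, A.comul (E s a i b j) = ∑ c, ∑ l, E s a i c l ⊗ₜ[k] E s c l b j) ∧
        (∀ s a i b j, A.counit (E s a i b j) = if a = b ∧ i = j then 1 else 0) ∧
        (∀ s (a : (D s).cls) i (b : (D s).cls) j t (c : (D t).cls) x (d : (D t).cls) y,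
          let w : G := (b : G)⁻¹ * ((c : G) * (d : G)⁻¹) * b
          A.bracket (E s a i b j ⊗ₜ[k] E t c x d y) =
            if ((a : G) * (b : G)⁻¹) * ((c : G) * (d : G)⁻¹) = w then
              m s ((D s).zeta a w⁻¹) j i • X.act (b : G)⁻¹ (E t c x d y)
            else 0) ∧
        (∀ s (a : (D s).cls) i (b : (D s).cls) j t (c : (D t).cls) x (d : (D t).cls) y,
          let w : G := (b : G)⁻¹ * ((c : G) * (d : G)⁻¹) * b
          A.fundamentalBraiding (E s a i b j ⊗ₜ[k] E t c x d y) =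
            X.act (b : G)⁻¹ (E t c x d y) ⊗ₜ[k]
              inc s ((blockCrossed (D s) (π s)).act w⁻¹ (vecE (D s) (v s) a i) ⊗ₜ[k]
                covecE (D s) (v s) b j)) ∧
        A.IsRegular ∧
        -- a summand given by the trivial pair `({e}, 1)` provides a unit
        (∀ s₀, (D s₀).r = 1 → Module.finrank k (W s₀) = 1 → (∀ n, π s₀ n = LinearMap.id) →
          ∃ η, A.IsUnitMap η ∧ η 1 = ∑ c, ∑ i, E s₀ c i c i)) := by
  refine ⟨fun s => ⟨fun h a i b j => blockEndCrossed_act_matE (D s) (π s) (v s) h a i b j,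
    fun g a i b j => blockEndCrossed_proj_matE (D s) (π s) (v s) g a i b j,
    (blockMatrix (D s) (π s) (v s)).algebra, fun a i b j => ?_, fun a i b j => ?_,
    fun a i b j c x d y => ?_, fun a i b j c x d y => ?_,
    (blockMatrix (D s) (π s) (v s)).algebra_isRegular, ?_⟩,
    (sumMatrix D π v).algebra, fun s a i b j => ?_, fun s a i b j => ?_,
    fun s a i b j t c x d y => ?_, fun s a i b j t c x d y => ?_,
    (sumMatrix D π v).algebra_isRegular, fun s₀ hr hdim hπ => ?_⟩
  · have := (blockMatrix (D s) (π s) (v s)).comul_inc () (vecE (D s) (v s) a i)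
      (covecE (D s) (v s) b j)
    rw [Fintype.sum_sigma] at this
    simp only [blockMatrix, blockBasis_apply, blockBasis_coord] at this
    exact this
  · exact ((blockMatrix (D s) (π s) (v s)).counit_inc () (vecE (D s) (v s) a i)
      (covecE (D s) (v s) b j)).trans (covecE_vecE (D s) (v s) b j a i)
  · have hx := (blockMatrix (D s) (π s) (v s)).proj_generator () ⟨c, x⟩ ⟨d, y⟩
    have hb := (blockMatrix (D s) (π s) (v s)).bracket_tmul (s := ()) (vecE (D s) (v s) a i)
      ((blockMatrix (D s) (π s) (v s)).coord_comp_proj () ⟨b, j⟩) hx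
    simp only [blockMatrix, blockBasis_apply, blockBasis_coord] at hb
    rw [covecE_act_vecE_of_degree, ite_smul, zero_smul] at hb
    exact hb
  · have hx := (blockMatrix (D s) (π s) (v s)).proj_generator () ⟨c, x⟩ ⟨d, y⟩
    have hb := (blockMatrix (D s) (π s) (v s)).fundamentalBraiding_tmul (s := ())
      (vecE (D s) (v s) a i) ((blockMatrix (D s) (π s) (v s)).coord_comp_proj () ⟨b, j⟩) hx
    simp only [blockMatrix, blockBasis_apply, blockBasis_coord] at hb
    exact hb
  · rw [(blockMatrix (D s) (π s) (v s)).algebra_isUnital_iff,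
      Module.finrank_eq_card_basis (blockBasis (D s) (v s))]
  · have := (sumMatrix D π v).comul_inc s (vecE (D s) (v s) a i) (covecE (D s) (v s) b j)
    rw [Fintype.sum_sigma] at this
    simp only [sumMatrix, blockBasis_apply, blockBasis_coord] at this
    exact this
  · exact ((sumMatrix D π v).counit_inc s (vecE (D s) (v s) a i)
      (covecE (D s) (v s) b j)).trans (covecE_vecE (D s) (v s) b j a i)
  · have hx := (sumMatrix D π v).proj_generator t ⟨c, x⟩ ⟨d, y⟩
    have hb := (sumMatrix D π v).bracket_tmul (s := s) (vecE (D s) (v s) a i)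
      ((sumMatrix D π v).coord_comp_proj s ⟨b, j⟩) hx
    simp only [sumMatrix, blockBasis_apply, blockBasis_coord] at hb
    rw [covecE_act_vecE_of_degree, ite_smul, zero_smul] at hb
    exact hb
  · have hx := (sumMatrix D π v).proj_generator t ⟨c, x⟩ ⟨d, y⟩
    have hb := (sumMatrix D π v).fundamentalBraiding_tmul (s := s) (vecE (D s) (v s) a i)
      ((sumMatrix D π v).coord_comp_proj s ⟨b, j⟩) hx
    simp only [sumMatrix, blockBasis_apply, blockBasis_coord] at hb
    exact hb
  -- For the trivial pair the class is `{1}`, so the block has a single basis vector, of degree `1`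
  -- and with trivial action; its identity matrix then acts as the identity on every block.
  · have hcls : ∀ c : (D s₀).cls, (c : G) = 1 := fun c =>
      isConj_one_right.1 (hr ▸ (show IsConj (D s₀).r c from c.2))
    have : Subsingleton (D s₀).cls := ⟨fun a b => Subtype.ext ((hcls a).trans (hcls b).symm)⟩
    obtain ⟨i₀, hi₀⟩ := Fintype.card_eq_one_iff.1
      ((Module.finrank_eq_card_basis (v s₀)).symm.trans hdim)
    let c₀ : (D s₀).cls := ⟨_, mem_conjugatesOf_self⟩
    let _ : Unique (Σ _ : (D s₀).cls, I s₀) :=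
      ⟨⟨⟨c₀, i₀⟩⟩, fun ⟨a, i⟩ => by rw [hi₀ i, Subsingleton.elim a c₀]; rfl⟩
    have hact : ∀ h w, (blockCrossed (D s₀) (π s₀)).act h w = w := fun h w => by
      have : (blockCrossed (D s₀) (π s₀)).act h = LinearMap.id := by
        refine (blockBasis (D s₀) (v s₀)).ext fun ⟨a, i⟩ => ?_
        rw [blockBasis_apply, vecE, blockCrossed_act_single, hπ,
          Subsingleton.elim (BasedClass.conj _ h a) a]
        rfl
      rw [this, LinearMap.id_apply]
    refine ⟨_, (sumMatrix D π v).isUnitMap_one s₀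
      ((sumMatrix D π v).bracket_one_of_trivial s₀ (hcls c₀) hact), ?_⟩
    rw [LinearMap.toSpanSingleton_apply_one, MatrixBlocks.one, Fintype.sum_sigma]
    simp only [sumMatrix, blockBasis_apply, blockBasis_coord]
    rfl
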